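/- Let $\mathbb K\in\{\mathbb R,\mathbb C\}$ and let $J^\infty=J^\infty(t|u)$ be the infinite jet space with coordinates $t,u_0,u_1,u_2,\dots$ (with the product topology; $u_k$ represents the $k$-th derivative of $u$). A \emph{differential function} on an open set $\Omega\subseteq J^\infty$ is a $\mathbb K$-valued function on $\Omega$ that is a smooth function of $t$ and finitely many of the $u_k$ (over $\mathbb C$: complex-smooth, i.e. holomorphic). Let $\mathrm D_t=\partial_t+\sum_k u_{k+1}\partial_{u_k}$ be the total derivative. Call differential functions $f^1,\dots,f^k$ \emph{totally linearly independent} on an open set $\Omega$ if they are linearly independent over $\mathbb K$ on every nonempty open subset of $\Omega$. Let $\mathrm W(f^1,\dots,f^k)=\det(\mathrm D_t^{l'-1}f^l)_{l,l'=1,\dots,k}$, and, where $\mathrm W(f^1,\dots,f^p)\ne0$, let $\mathrm{DT}[f^1,\dots,f^p]=\sum_{k=0}^p\psi^k\mathrm D_t^k$ be the Darboux operator, defined by $$\mathrm{DT}[f^1,\dots,f^p]G=\frac{\mathrm W(f^1,\dots,f^p,G)}{\mathrm W(f^1,\dots,f^p)},$$ with formal adjoint $\mathrm{DT}[f^1,\dots,f^p]^\dagger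 F=\sum_{k=0}^p(-\mathrm D_t)^k(\psi^kF)$. \textbf{Theorem.} Let $\Omega\subseteq J^\infty$ be open, let $L$ and $\lambda^1,\dots,\lambda^p$ ($p\ge0$) be differential functions on $\Omega$, where $\lambda^1,\dots,\lambda^p$ are totally linearly independent on $\Omega$, and let $\Omega'=\{x\in\Omega:\mathrm W(\lambda^1,\dots,\lambda^p)(x)\neq0\}$ be the set where $\mathrm{DT}[\lambda^1,\dots,\lambda^p]$ is defined. (1) The equation $L=0$ admits first integrals with associated integrating factors $\lambda^1,\dots,\lambda^p$ on $\Omega'$, i.e. there are differential functions $I^1,\dots,I^p$ on $\Omega'$ with $\mathrm D_tI^s=\lambda^sL$ on $\Omega'$ for $s=1,\dots,p$, if and only if there is a differential function $H$ on $\Omega'$ such that $$L=\mathrm{DT}[\lambda^1,\dots,\lambda^p]^\dagger H\quad\text{on }\Omega'.$$ (2) If moreover $L$ vanishes identically on no nonempty open subset of $\Omega$, then this representation with some differential function $H$ on $\Omega'$ exists if and only if $L=0$ admits first integrals $I^1,\dots,I^p$ as in (1) that are totally linearly independent on $\Omega'$ modulo constants, i.e. $1,I^1,\dots,I^p$ are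 totally linearly independent on $\Omega'$. -/

import Mathlib

open scoped ContDiff

noncomputable section

/-- The infinite jet space `J^∞(t|u)` with one independent variable `t` and one dependent variable
`u`. A point is `x = (t, (u₀, u₁, u₂, …))`, where `u_k` stands for the `k`-th derivative of `u`.
It carries the product topology. -/
abbrev JetSpace (𝕜 : Type*) : Type _ := 𝕜 × (ℕ → 𝕜)

/-- The projection of a jet onto the finitely many coordinates `(t, u₀, …, u_{n-1})`. -/
def jetProj {𝕜 : Type*} (n : ℕ) (x : JetSpace 𝕜) : 𝕜 × (Fin n → 𝕜) :=
  (x.1, fun k => x.2 k)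

/-- `f` is a differential function on `Ω`: on `Ω` it is a smooth function of `t` and of finitely
many of the derivatives of `u`. Functions on the jet space are total in Lean; their values outside
`Ω` are irrelevant. -/
def IsDifferentialFunction {𝕜 : Type*} [RCLike 𝕜] (Ω : Set (JetSpace 𝕜))
    (f : JetSpace 𝕜 → 𝕜) : Prop :=
  ∃ (n : ℕ) (g : 𝕜 × (Fin n → 𝕜) → 𝕜),
    ContDiffOn 𝕜 ∞ g (jetProj n '' Ω) ∧ ∀ x ∈ Ω, f x = g (jetProj n x)

/-- The total derivative `D_t = ∂_t + ∑_k u_{k+1} ∂_{u_k}`. At a point of an open set on which `f`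
is a differential function only finitely many summands are nonzero. -/
def totalDeriv {𝕜 : Type*} [RCLike 𝕜] (f : JetSpace 𝕜 → 𝕜) : JetSpace 𝕜 → 𝕜 := fun x =>
  deriv (fun τ : 𝕜 => f (τ, x.2)) x.1 +
    ∑ᶠ k : ℕ, x.2 (k + 1) * deriv (fun v : 𝕜 => f (x.1, Function.update x.2 k v)) (x.2 k)

/-- The Wronskian `W(f¹,…,f^k) = det (D_t^{l'-1} f^l)_{l,l'=1,…,k}` in the total derivative. -/
def totalWronskian {𝕜 : Type*} [RCLike 𝕜] {k : ℕ} (f : Fin k → JetSpace 𝕜 → 𝕜) :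
    JetSpace 𝕜 → 𝕜 := fun x =>
  (Matrix.of fun l l' : Fin k => (totalDeriv^[(l' : ℕ)] (f l)) x).det

/-- The functions `f^s` are totally linearly independent on `Ω`: they are linearly independent
(over the constants) on every nonempty open subset of `Ω`. -/
def TotallyLinearlyIndependent {𝕜 : Type*} [RCLike 𝕜] {ι : Type*} (Ω : Set (JetSpace 𝕜))
    (f : ι → JetSpace 𝕜 → 𝕜) : Prop :=
  ∀ V : Set (JetSpace 𝕜), IsOpen V → V.Nonempty → V ⊆ Ω →
    LinearIndependent 𝕜 fun s => V.domRestrict (f s)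

/-- The action `G ↦ ∑_k ψ^k D_t^k G` of the linear differential operator in the total derivative
with coefficients `ψ⁰, …, ψⁿ`. -/
def totalOpApply {𝕜 : Type*} [RCLike 𝕜] {n : ℕ} (ψ : Fin (n + 1) → JetSpace 𝕜 → 𝕜)
    (G : JetSpace 𝕜 → 𝕜) : JetSpace 𝕜 → 𝕜 := fun x =>
  ∑ k : Fin (n + 1), ψ k x * (totalDeriv^[(k : ℕ)] G) x

/-- The action `F ↦ ∑_k (-D_t)^k (ψ^k F)` of the formal adjoint of the operator `∑_k ψ^k D_t^k`. -/
def totalOpAdjointApply {𝕜 : Type*} [RCLike 𝕜] {n : ℕ} (ψ : Fin (n + 1) → JetSpace 𝕜 → 𝕜)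
    (F : JetSpace 𝕜 → 𝕜) : JetSpace 𝕜 → 𝕜 := fun x =>
  ∑ k : Fin (n + 1), (-1) ^ (k : ℕ) * (totalDeriv^[(k : ℕ)] fun y => ψ k y * F y) x

/-- The Darboux transformation `DT[f¹,…,f^p] G = W(f¹,…,f^p,G) / W(f¹,…,f^p)`; it is meaningful at
the points where the denominator does not vanish. -/
def darbouxTransformation {𝕜 : Type*} [RCLike 𝕜] {p : ℕ} (f : Fin p → JetSpace 𝕜 → 𝕜)
    (G : JetSpace 𝕜 → 𝕜) : JetSpace 𝕜 → 𝕜 := fun x =>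
  totalWronskian (Fin.snoc f G : Fin (p + 1) → JetSpace 𝕜 → 𝕜) x / totalWronskian f x

/-- The coefficients of the Darboux operator `DT[f¹,…,f^p] = ∑_{k=0}^p ψ^k D_t^k`, read off by
expanding `W(f¹,…,f^p,G)` along the row of `G`. -/
def darbouxCoeff {𝕜 : Type*} [RCLike 𝕜] {p : ℕ} (f : Fin p → JetSpace 𝕜 → 𝕜)
    (k : Fin (p + 1)) : JetSpace 𝕜 → 𝕜 := fun x =>
  (-1) ^ (p + (k : ℕ)) *
    (Matrix.of fun l l' : Fin p => (totalDeriv^[(k.succAbove l' : ℕ)] (f l)) x).det /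
      totalWronskian f x

/-- The operator with the coefficients `darbouxCoeff f` is the Darboux transformation. -/
theorem totalOpApply_darbouxCoeff {𝕜 : Type*} [RCLike 𝕜] {p : ℕ}
    (f : Fin p → JetSpace 𝕜 → 𝕜) (G : JetSpace 𝕜 → 𝕜) :
    totalOpApply (darbouxCoeff f) G = darbouxTransformation f G := by
  funext x
  have h : totalWronskian (Fin.snoc f G : Fin (p + 1) → JetSpace 𝕜 → 𝕜) x =
      ∑ k : Fin (p + 1), (-1) ^ (p + (k : ℕ)) * (totalDeriv^[(k : ℕ)] G) x *
        (Matrix.of fun l l' : Fin p =>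
          (totalDeriv^[(k.succAbove l' : ℕ)] (f l)) x).det := by
    unfold totalWronskian
    rw [Matrix.det_succ_row _ (Fin.last p)]
    refine Finset.sum_congr rfl fun k _ => ?_
    congr 1
    · simp
    · congr 1
      ext l l'
      simp
  unfold totalOpApply darbouxTransformation darbouxCoeff
  rw [h, Finset.sum_div]
  refine Finset.sum_congr rfl fun k _ => ?_
  ring

/-- The formally adjoint Darboux operator `DT[f¹,…,f^p]^†`. -/
def darbouxAdjoint {𝕜 : Type*} [RCLike 𝕜] {p : ℕ} (f : Fin p → JetSpace 𝕜 → 𝕜)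
    (H : JetSpace 𝕜 → 𝕜) : JetSpace 𝕜 → 𝕜 :=
  totalOpAdjointApply (darbouxCoeff f) H

/-- The part of `Ω` where the Darboux operator `DT[f¹,…,f^p]` is defined, that is, where the
Wronskian of `f¹,…,f^p` does not vanish. -/
def darbouxDomain {𝕜 : Type*} [RCLike 𝕜] {p : ℕ} (Ω : Set (JetSpace 𝕜))
    (f : Fin p → JetSpace 𝕜 → 𝕜) : Set (JetSpace 𝕜) :=
  {x ∈ Ω | totalWronskian f x ≠ 0}

/-- `I` is a first integral of the equation `L = 0` on `Ω` with associated integrating factor `μ`: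
it is a differential function with `D_t I = μ L`. -/
def IsFirstIntegralWith {𝕜 : Type*} [RCLike 𝕜] (Ω : Set (JetSpace 𝕜))
    (L μ I : JetSpace 𝕜 → 𝕜) : Prop :=
  IsDifferentialFunction Ω I ∧ ∀ x ∈ Ω, totalDeriv I x = μ x * L x

/-- `L` vanishes identically on no nonempty open subset of `Ω`, so that `L = 0` is a genuine
equation everywhere. -/
def IsGenuineEquation {𝕜 : Type*} [RCLike 𝕜] (Ω : Set (JetSpace 𝕜))
    (L : JetSpace 𝕜 → 𝕜) : Prop :=
  ∀ V : Set (JetSpace 𝕜), IsOpen V → V.Nonempty → V ⊆ Ω → ∃ x ∈ V, L x ≠ 0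

end

/-! Part (1) is Lagrange's identity for an operator `P = ∑ ψ k * D^k` with `ψ p = 1` that kills
every `λˢ`: `λˢ * P†H` differs from `H * P λˢ = 0` by a total derivative. Its potential is `Iˢ = -∑
D^l λˢ * h (l + 1)` over `l < p`, where the Horner scheme `h p = H`, `h k = ψ k * H - D (h (k + 1))`
ends in `h 0 = P†H`.

Conversely, given the `Iˢ`, invertibility of the Wronskian matrix lets one solve these formulas for
`h 1, …, h p`. Put `h 0 = L`. Then `D Iˢ = λˢ * L` says that the Wronskian matrix kills the vector
of defects in the Horner recursion, so the recursion holds and `L = P†(h p)`. This is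
`Derivation.exists_integral_iff_exists_adjoint`, valid in any commutative differential ring. It
applies to the differential functions on `Ω'`, where the Wronskian is a unit and the Darboux
operator is monic and kills each `λˢ`.

For part (2), applying `D_t` to a relation among `1, Iˢ` gives `(∑ c_s λˢ) L = 0`; where `L ≠ 0`
this is a relation among the `λˢ`. -/

/-! ### Lagrange's identity in a commutative differential ring -/

section DifferentialRing

variable {R : Type*} [CommRing R] (D : Derivation ℤ R R)

theorem Derivation.horner_eq_sum {a h : ℕ → R} {p : ℕ}
    (hh : ∀ k < p, h k = a k - D (h (k + 1))) :
    h 0 = ∑ k ∈ Finset.range p, (-1) ^ k * D^[k] (a k) + (-1) ^ p * D^[p] (h p) := by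
  induction p with
  | zero => simp
  | succ p ih =>
    rw [ih fun k hk => hh k (hk.trans p.lt_succ_self), Finset.sum_range_succ, add_assoc,
      hh p p.lt_succ_self, iterate_map_sub, Function.iterate_succ_apply]
    ring

theorem Derivation.exists_horner (a : ℕ → R) (p : ℕ) :
    ∃ h : ℕ → R, h p = a p ∧ ∀ k < p, h k = a k - D (h (k + 1)) := by
  -- The recursion unrolled from the top index `p` down to `k`.
  refine ⟨fun k => ∑ j ∈ Finset.range (p - k + 1), (-1) ^ j * D^[j] (a (k + j)), by simp, ?_⟩
  intro k hk
  obtain ⟨m, rfl⟩ := Nat.exists_eq_add_of_lt hk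
  have e₁ : k + m + 1 - k + 1 = m + 1 + 1 := by omega
  have e₂ : k + m + 1 - (k + 1) + 1 = m + 1 := by omega
  simp only [e₁, e₂]
  rw [Finset.sum_range_succ', map_sum, add_comm, sub_eq_add_neg, ← Finset.sum_neg_distrib]
  congr 1
  · simp
  · refine Finset.sum_congr rfl fun j _ => ?_
    have hD : D ((-1) ^ j * D^[j] (a (k + 1 + j))) = (-1) ^ j * D (D^[j] (a (k + 1 + j))) := by
      rcases neg_one_pow_eq_or R j with h | h <;> simp [h]
    rw [hD, Function.iterate_succ_apply', pow_succ, add_right_comm, add_assoc]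
    ring_nf

/-- Lagrange's identity with `h` left arbitrary: the last sum measures the failure of the Horner
recursion. Keeping this defect lets one formula serve both directions of the equivalence. The proof
telescopes `D^l lam * h l` and eliminates `D^p lam` through the equation for `lam`. -/
theorem Derivation.sum_bilinear_concomitant {lam : R} {ψ h : ℕ → R} {p : ℕ} (hψ : ψ p = 1)
    (hlam : ∑ k ∈ Finset.range (p + 1), ψ k * D^[k] lam = 0) :
    D (-∑ l ∈ Finset.range p, D^[l] lam * h (l + 1)) =
      lam * h 0 + ∑ l ∈ Finset.range p, D^[l] lam * (ψ l * h p - D (h (l + 1)) - h l) := by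
  have htel := Finset.sum_range_sub (fun l => D^[l] lam * h l) p
  rw [Finset.sum_range_succ, hψ, one_mul] at hlam
  have h₁ : D (-∑ l ∈ Finset.range p, D^[l] lam * h (l + 1)) =
      -∑ l ∈ Finset.range p, (D^[l] lam * D (h (l + 1)) + D^[l + 1] lam * h (l + 1)) := by
    rw [map_neg, map_sum]
    congr 1
    refine Finset.sum_congr rfl fun l _ => ?_
    rw [D.leibniz, Function.iterate_succ_apply', smul_eq_mul, smul_eq_mul]
    ring
  have h₂ : ∑ l ∈ Finset.range p, D^[l] lam * (ψ l * h p - D (h (l + 1)) - h l) =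
      (∑ l ∈ Finset.range p, ψ l * D^[l] lam) * h p
        - ∑ l ∈ Finset.range p, (D^[l] lam * D (h (l + 1)) + D^[l + 1] lam * h (l + 1))
        + ∑ l ∈ Finset.range p, (D^[l + 1] lam * h (l + 1) - D^[l] lam * h l) := by
    rw [Finset.sum_mul, ← Finset.sum_sub_distrib, ← Finset.sum_add_distrib]
    exact Finset.sum_congr rfl fun l _ => by ring
  rw [h₁, h₂, htel, Function.iterate_zero, id]
  linear_combination (-h p) * hlam

/-- If `∑ ψ k D ^ k` is monic, annihilates every `lam s` and the Wronskian matrix of `lam` is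
invertible, then all `lam s * L` are derivatives iff `L` is in the image of the adjoint operator. -/
theorem Derivation.exists_integral_iff_exists_adjoint {p : ℕ} {lam : Fin p → R} {ψ : ℕ → R}
    (hψ : ψ p = 1) (hlam : ∀ s, ∑ k ∈ Finset.range (p + 1), ψ k * D^[k] (lam s) = 0)
    (hM : IsUnit (Matrix.of fun s l : Fin p => D^[(l : ℕ)] (lam s)).det) (L : R) :
    (∃ I : Fin p → R, ∀ s, D (I s) = lam s * L) ↔
      ∃ H, L = ∑ k ∈ Finset.range (p + 1), (-1) ^ k * D^[k] (ψ k * H) := by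
  constructor
  · rintro ⟨I, hI⟩
    set M : Matrix (Fin p) (Fin p) R := Matrix.of fun s l => D^[(l : ℕ)] (lam s) with hMdef
    let v : Fin p → R := -(M⁻¹.mulVec I)
    -- The value `0` past index `p` is never used. For `p = 0` the top entry `h p` is `L` itself.
    let h : ℕ → R
      | 0 => L
      | l + 1 => if hl : l < p then v ⟨l, hl⟩ else 0
    have hMv : ∀ s, I s = -∑ l ∈ Finset.range p, D^[l] (lam s) * h (l + 1) := by
      intro s
      rw [← Fin.sum_univ_eq_sum_range (fun l => D^[l] (lam s) * h (l + 1)) p]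
      have hv : M.mulVec v = -I := by
        rw [Matrix.mulVec_neg, Matrix.mulVec_mulVec, Matrix.mul_nonsing_inv _ hM,
          Matrix.one_mulVec]
      have := congrFun hv s
      simp only [Matrix.mulVec, dotProduct, Pi.neg_apply] at this
      rw [← neg_eq_iff_eq_neg, ← this]
      exact Finset.sum_congr rfl fun l _ => by simp [hMdef, h]
    have hw : M.mulVec (fun l => ψ l * h p - D (h (l + 1)) - h l) = 0 := by
      funext s
      have := D.sum_bilinear_concomitant (h := h) hψ (hlam s)
      rw [← hMv s, hI s, left_eq_add,
        ← Fin.sum_univ_eq_sum_range (fun l => D^[l] (lam s) * (ψ l * h p - D (h (l + 1)) - h l)) p]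
        at this
      exact this
    have hw' : (fun l : Fin p => ψ l * h p - D (h (l + 1)) - h l) = 0 := by
      rw [← Matrix.one_mulVec (fun l : Fin p => _), ← Matrix.nonsing_inv_mul M hM,
        ← Matrix.mulVec_mulVec, hw, Matrix.mulVec_zero]
    refine ⟨h p, ?_⟩
    rw [Finset.sum_range_succ, hψ, one_mul]
    exact D.horner_eq_sum (a := fun k => ψ k * h p) (h := h) fun k hk =>
      (sub_eq_zero.1 (congrFun hw' ⟨k, hk⟩)).symm
  · rintro ⟨H, hH⟩
    obtain ⟨h, hp, hh⟩ := D.exists_horner (fun k => ψ k * H) p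
    have hL : L = h 0 := by
      rw [D.horner_eq_sum hh, hH, Finset.sum_range_succ, hp]
    rw [hψ, one_mul] at hp
    refine ⟨fun s => -∑ l ∈ Finset.range p, D^[l] (lam s) * h (l + 1), fun s => ?_⟩
    rw [D.sum_bilinear_concomitant hψ (hlam s), hL, add_eq_left]
    refine Finset.sum_eq_zero fun l hl => ?_
    rw [hp, hh l (Finset.mem_range.1 hl), sub_self, mul_zero]

end DifferentialRing

/-! ### Differential functions on open sets of jets -/

noncomputable section

variable {𝕜 : Type*} [RCLike 𝕜] {Ω : Set (JetSpace 𝕜)} {f g : JetSpace 𝕜 → 𝕜}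

/-- Near each image point there is a continuous section of the projection, which freezes the
remaining coordinates at those of `x`. -/
theorem isOpen_image_jetProj (hΩ : IsOpen Ω) (n : ℕ) : IsOpen (jetProj n '' Ω) := by
  rw [isOpen_iff_mem_nhds]
  rintro _ ⟨x, hx, rfl⟩
  let σ : 𝕜 × (Fin n → 𝕜) → JetSpace 𝕜 :=
    fun y => (y.1, fun k => if h : k < n then y.2 ⟨k, h⟩ else x.2 k)
  have hσ : Continuous σ := by
    refine continuous_fst.prodMk (continuous_pi fun k => ?_)
    by_cases h : k < n
    · simp only [h, dite_true]
      fun_prop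
    · simp only [h, dite_false]
      fun_prop
  have hσx : σ (jetProj n x) = x := by
    refine Prod.ext rfl (funext fun k => ?_)
    simp [σ, jetProj]
  refine Filter.mem_of_superset
    ((hΩ.preimage hσ).mem_nhds (by rwa [Set.mem_preimage, hσx])) fun y hy => ⟨σ y, hy, ?_⟩
  refine Prod.ext rfl (funext fun k => ?_)
  simp [σ, jetProj]

theorem continuous_jetProj (n : ℕ) : Continuous (jetProj n : JetSpace 𝕜 → _) := by
  unfold jetProj
  fun_prop

theorem IsDifferentialFunction.mono {U : Set (JetSpace 𝕜)} (hf : IsDifferentialFunction Ω f)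
    (hU : U ⊆ Ω) : IsDifferentialFunction U f := by
  obtain ⟨n, φ, hφ, h⟩ := hf
  exact ⟨n, φ, hφ.mono (Set.image_mono hU), fun x hx => h x (hU hx)⟩

theorem IsDifferentialFunction.congr (hf : IsDifferentialFunction Ω f) (hfg : Set.EqOn g f Ω) :
    IsDifferentialFunction Ω g := by
  obtain ⟨n, φ, hφ, h⟩ := hf
  exact ⟨n, φ, hφ, fun x hx => (hfg hx).trans (h x hx)⟩

theorem isDifferentialFunction_const (c : 𝕜) : IsDifferentialFunction Ω fun _ => c :=
  ⟨0, fun _ => c, contDiffOn_const, fun _ _ => rfl⟩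

theorem IsDifferentialFunction.continuousOn (hf : IsDifferentialFunction Ω f) :
    ContinuousOn f Ω := by
  obtain ⟨n, φ, hφ, h⟩ := hf
  exact (hφ.continuousOn.comp (continuous_jetProj n).continuousOn
    (Set.mapsTo_image _ _)).congr h

/-- Dummy variables may be added, so two differential functions can be represented on the same
finite set of coordinates. -/
theorem IsDifferentialFunction.eventually_exists (hf : IsDifferentialFunction Ω f) :
    ∃ n : ℕ, ∀ m ≥ n, ∃ φ : 𝕜 × (Fin m → 𝕜) → 𝕜,
      ContDiffOn 𝕜 ∞ φ (jetProj m '' Ω) ∧ ∀ x ∈ Ω, f x = φ (jetProj m x) := by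
  obtain ⟨n, φ, hφ, h⟩ := hf
  refine ⟨n, fun m hm => ⟨fun y => φ (y.1, fun k => y.2 (k.castLE hm)), ?_, h⟩⟩
  refine hφ.comp (t := jetProj n '' Ω) (f := fun y : 𝕜 × (Fin m → 𝕜) =>
    (y.1, fun k => y.2 (Fin.castLE hm k))) (ContDiff.contDiffOn (by fun_prop)) ?_
  rintro _ ⟨x, hx, rfl⟩
  exact ⟨x, hx, rfl⟩

theorem IsDifferentialFunction.exists_common (hf : IsDifferentialFunction Ω f)
    (hg : IsDifferentialFunction Ω g) :
    ∃ (n : ℕ) (φ χ : 𝕜 × (Fin n → 𝕜) → 𝕜),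
      (ContDiffOn 𝕜 ∞ φ (jetProj n '' Ω) ∧ ∀ x ∈ Ω, f x = φ (jetProj n x)) ∧
      (ContDiffOn 𝕜 ∞ χ (jetProj n '' Ω) ∧ ∀ x ∈ Ω, g x = χ (jetProj n x)) := by
  obtain ⟨m, hm⟩ := hf.eventually_exists
  obtain ⟨n, hn⟩ := hg.eventually_exists
  obtain ⟨φ, hφ⟩ := hm (max m n) (le_max_left _ _)
  obtain ⟨χ, hχ⟩ := hn (max m n) (le_max_right _ _)
  exact ⟨_, φ, χ, hφ, hχ⟩

theorem IsDifferentialFunction.add (hf : IsDifferentialFunction Ω f)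
    (hg : IsDifferentialFunction Ω g) : IsDifferentialFunction Ω fun x => f x + g x := by
  obtain ⟨n, φ, χ, ⟨hφ, hf⟩, hχ, hg⟩ := hf.exists_common hg
  exact ⟨n, fun y => φ y + χ y, hφ.add hχ, fun x hx => congrArg₂ _ (hf x hx) (hg x hx)⟩

theorem IsDifferentialFunction.mul (hf : IsDifferentialFunction Ω f)
    (hg : IsDifferentialFunction Ω g) : IsDifferentialFunction Ω fun x => f x * g x := by
  obtain ⟨n, φ, χ, ⟨hφ, hf⟩, hχ, hg⟩ := hf.exists_common hg
  exact ⟨n, fun y => φ y * χ y, hφ.mul hχ, fun x hx => congrArg₂ _ (hf x hx) (hg x hx)⟩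

theorem IsDifferentialFunction.inv (hf : IsDifferentialFunction Ω f) (h0 : ∀ x ∈ Ω, f x ≠ 0) :
    IsDifferentialFunction Ω fun x => (f x)⁻¹ := by
  obtain ⟨n, φ, hφ, h⟩ := hf
  refine ⟨n, fun y => (φ y)⁻¹, hφ.inv ?_, fun x hx => congrArg _ (h x hx)⟩
  rintro _ ⟨x, hx, rfl⟩
  exact h x hx ▸ h0 x hx

/-! ### The total derivative -/

/-- Chain rule: partial derivatives in `u_k` with `k ≥ n` vanish, and the others assemble into one
directional derivative. The sum and product rules then follow from those of `fderiv`. -/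
theorem totalDeriv_eq_fderiv (hΩ : IsOpen Ω) {n : ℕ} {φ : 𝕜 × (Fin n → 𝕜) → 𝕜}
    (h : ∀ x ∈ Ω, f x = φ (jetProj n x)) {x : JetSpace 𝕜} (hx : x ∈ Ω)
    (hφ : DifferentiableAt 𝕜 φ (jetProj n x)) :
    totalDeriv f x = fderiv 𝕜 φ (jetProj n x) (1, fun k => x.2 (k + 1)) := by
  have ht : deriv (fun τ : 𝕜 => f (τ, x.2)) x.1 = fderiv 𝕜 φ (jetProj n x) (1, 0) := by
    have hc : Continuous fun τ : 𝕜 => ((τ, x.2) : JetSpace 𝕜) := by fun_prop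
    have hev : (fun τ : 𝕜 => f (τ, x.2)) =ᶠ[nhds x.1] fun τ => φ (τ, (jetProj n x).2) := by
      filter_upwards [(hΩ.preimage hc).mem_nhds (show x.1 ∈ _ from hx)] with τ hτ
      exact h _ hτ
    rw [hev.deriv_eq]
    exact (hφ.hasFDerivAt.comp_hasDerivAt x.1
      ((hasDerivAt_id x.1).prodMk (hasDerivAt_const x.1 (jetProj n x).2))).deriv
  have hev : ∀ k : ℕ, (fun v : 𝕜 => f (x.1, Function.update x.2 k v)) =ᶠ[nhds (x.2 k)]
      fun v => φ (jetProj n (x.1, Function.update x.2 k v)) := by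
    intro k
    have hc : Continuous fun v : 𝕜 => ((x.1, Function.update x.2 k v) : JetSpace 𝕜) :=
      continuous_const.prodMk (continuous_const.update k continuous_id)
    filter_upwards [(hΩ.preimage hc).mem_nhds (show x.2 k ∈ _ by simpa using hx)] with v hv
    exact h _ hv
  have hlt : ∀ k : Fin n, deriv (fun v : 𝕜 => f (x.1, Function.update x.2 k v)) (x.2 k) =
      fderiv 𝕜 φ (jetProj n x) (0, Pi.single k 1) := by
    intro k
    rw [(hev k).deriv_eq]
    have hup : ∀ v : 𝕜, jetProj n (x.1, Function.update x.2 k v) =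
        (x.1, Function.update (jetProj n x).2 k v) := by
      intro v
      refine Prod.ext rfl (funext fun j => ?_)
      simp [jetProj, Function.update_apply, Fin.ext_iff]
    simp only [hup]
    have hd : HasDerivAt (fun v : 𝕜 => (x.1, Function.update (jetProj n x).2 k v))
        (0, Pi.single k 1) (x.2 k) :=
      (hasDerivAt_const _ _).prodMk (hasDerivAt_update _ k _)
    refine (HasFDerivAt.comp_hasDerivAt (x.2 k) (l := φ) ?_ hd).deriv
    have : (x.1, Function.update (jetProj n x).2 k (x.2 k)) = jetProj n x :=
      Prod.ext rfl (Function.update_eq_self k (jetProj n x).2)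
    rw [this]
    exact hφ.hasFDerivAt
  have hge : ∀ k : ℕ, n ≤ k → deriv (fun v : 𝕜 => f (x.1, Function.update x.2 k v)) (x.2 k) = 0 := by
    intro k hk
    rw [(hev k).deriv_eq]
    have hup : ∀ v : 𝕜, jetProj n (x.1, Function.update x.2 k v) = jetProj n x := by
      intro v
      refine Prod.ext rfl (funext fun j => ?_)
      exact Function.update_of_ne (by omega) _ _
    simp only [hup, deriv_const]
  rw [totalDeriv, ht, finsum_eq_sum_of_support_subset (s := Finset.range n),
    ← Fin.sum_univ_eq_sum_range
      (fun k => x.2 (k + 1) * deriv (fun v : 𝕜 => f (x.1, Function.update x.2 k v)) (x.2 k))]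
  · have hdec : ((1, fun k : Fin n => x.2 (k + 1)) : 𝕜 × (Fin n → 𝕜)) =
        (1, 0) + ∑ k : Fin n, x.2 (k + 1) • (0, Pi.single k 1) := by
      refine Prod.ext ?_ (funext fun j => ?_)
      · simp [Prod.fst_sum]
      · simp [Prod.snd_sum, Finset.sum_apply, Pi.single_apply]
    rw [hdec, map_add, map_sum]
    simp only [map_smul, smul_eq_mul, hlt]
  · intro k hk
    by_contra hkn
    exact hk (by simp [hge k (by simpa using hkn)])

theorem differentiableAt_of_contDiffOn_image_jetProj (hΩ : IsOpen Ω) {n : ℕ}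
    {φ : 𝕜 × (Fin n → 𝕜) → 𝕜} (hφ : ContDiffOn 𝕜 ∞ φ (jetProj n '' Ω)) {x : JetSpace 𝕜}
    (hx : x ∈ Ω) : DifferentiableAt 𝕜 φ (jetProj n x) :=
  (hφ.contDiffAt ((isOpen_image_jetProj hΩ n).mem_nhds ⟨x, hx, rfl⟩)).differentiableAt (by simp)

theorem IsDifferentialFunction.totalDeriv (hΩ : IsOpen Ω) (hf : IsDifferentialFunction Ω f) :
    IsDifferentialFunction Ω (totalDeriv f) := by
  obtain ⟨n, φ, hφ, h⟩ := hf
  -- The direction vector involves `u_n`, hence one more coordinate.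
  refine ⟨n + 1, fun y => fderiv 𝕜 φ (y.1, fun k => y.2 k.castSucc) (1, fun k => y.2 k.succ),
    ?_, fun x hx => totalDeriv_eq_fderiv hΩ h hx
      (differentiableAt_of_contDiffOn_image_jetProj hΩ hφ hx)⟩
  refine ContDiffOn.clm_apply ?_ (ContDiff.contDiffOn (by fun_prop))
  refine (hφ.fderiv_of_isOpen (isOpen_image_jetProj hΩ n) (m := ∞) (by simp)).comp
    (f := fun y : 𝕜 × (Fin (n + 1) → 𝕜) => (y.1, fun k : Fin n => y.2 k.castSucc))
    (ContDiff.contDiffOn (by fun_prop)) ?_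
  rintro _ ⟨x, hx, rfl⟩
  exact ⟨x, hx, rfl⟩

theorem totalDeriv_congr (hΩ : IsOpen Ω) (hf : IsDifferentialFunction Ω f)
    (hfg : Set.EqOn g f Ω) : Set.EqOn (totalDeriv g) (totalDeriv f) Ω := by
  obtain ⟨n, φ, hφ, h⟩ := hf
  intro x hx
  have hd := differentiableAt_of_contDiffOn_image_jetProj hΩ hφ hx
  rw [totalDeriv_eq_fderiv hΩ h hx hd,
    totalDeriv_eq_fderiv hΩ (fun y hy => (hfg hy).trans (h y hy)) hx hd]

theorem totalDeriv_add (hΩ : IsOpen Ω) (hf : IsDifferentialFunction Ω f)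
    (hg : IsDifferentialFunction Ω g) {x : JetSpace 𝕜} (hx : x ∈ Ω) :
    totalDeriv (fun y => f y + g y) x = totalDeriv f x + totalDeriv g x := by
  obtain ⟨n, φ, χ, ⟨hφ, hf⟩, hχ, hg⟩ := hf.exists_common hg
  have hφ' := differentiableAt_of_contDiffOn_image_jetProj hΩ hφ hx
  have hχ' := differentiableAt_of_contDiffOn_image_jetProj hΩ hχ hx
  rw [totalDeriv_eq_fderiv hΩ hf hx hφ', totalDeriv_eq_fderiv hΩ hg hx hχ',
    totalDeriv_eq_fderiv (φ := fun y => φ y + χ y) hΩ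
      (fun y hy => by rw [hf y hy, hg y hy]) hx (hφ'.add hχ'), fderiv_fun_add hφ' hχ']
  rfl

theorem totalDeriv_mul (hΩ : IsOpen Ω) (hf : IsDifferentialFunction Ω f)
    (hg : IsDifferentialFunction Ω g) {x : JetSpace 𝕜} (hx : x ∈ Ω) :
    totalDeriv (fun y => f y * g y) x = f x * totalDeriv g x + g x * totalDeriv f x := by
  obtain ⟨n, φ, χ, ⟨hφ, hf⟩, hχ, hg⟩ := hf.exists_common hg
  have hφ' := differentiableAt_of_contDiffOn_image_jetProj hΩ hφ hx
  have hχ' := differentiableAt_of_contDiffOn_image_jetProj hΩ hχ hx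
  rw [totalDeriv_eq_fderiv hΩ hf hx hφ', totalDeriv_eq_fderiv hΩ hg hx hχ',
    totalDeriv_eq_fderiv (φ := fun y => φ y * χ y) hΩ
      (fun y hy => by rw [hf y hy, hg y hy]) hx (hφ'.mul hχ'), fderiv_fun_mul hφ' hχ',
    hf x hx, hg x hx]
  rfl

theorem totalDeriv_const (c : 𝕜) : totalDeriv (fun _ : JetSpace 𝕜 => c) = 0 := by
  funext x
  simp [totalDeriv]

theorem IsDifferentialFunction.iterate_totalDeriv (hΩ : IsOpen Ω)
    (hf : IsDifferentialFunction Ω f) (k : ℕ) : IsDifferentialFunction Ω (_root_.totalDeriv^[k] f) := by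
  induction k with
  | zero => exact hf
  | succ k ih =>
    rw [Function.iterate_succ_apply']
    exact ih.totalDeriv hΩ

/-! ### The differential ring of differential functions -/

/-- Extension by zero of a function on a set of jets. -/
def jetExtend (f : Ω → 𝕜) : JetSpace 𝕜 → 𝕜 :=
  Function.extend Subtype.val f 0

theorem jetExtend_apply (f : Ω → 𝕜) {x : JetSpace 𝕜} (hx : x ∈ Ω) :
    jetExtend f x = f ⟨x, hx⟩ :=
  Subtype.val_injective.extend_apply f 0 ⟨x, hx⟩

/-- The algebra of differential functions on `Ω`. -/
def differentialFunctions (Ω : Set (JetSpace 𝕜)) : Subalgebra 𝕜 (Ω → 𝕜) where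
  carrier := {f | IsDifferentialFunction Ω (jetExtend f)}
  mul_mem' hf hg := (hf.mul hg).congr fun x hx => by simp [jetExtend_apply, hx]
  add_mem' hf hg := (hf.add hg).congr fun x hx => by simp [jetExtend_apply, hx]
  algebraMap_mem' c := (isDifferentialFunction_const c).congr fun x hx => by
    simp [jetExtend_apply, hx]

/-- A differential function on `Ω` as an element of the algebra of such functions. -/
def IsDifferentialFunction.toAlgebra (hf : IsDifferentialFunction Ω f) :
    differentialFunctions Ω :=
  ⟨fun x => f x, hf.congr fun _ hx => jetExtend_apply _ hx⟩

/-- The total derivative as a derivation of the algebra of differential functions. -/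
def totalDerivation (hΩ : IsOpen Ω) :
    Derivation ℤ (differentialFunctions Ω) (differentialFunctions Ω) :=
  Derivation.mk' (AddMonoidHom.toIntLinearMap
    { toFun := fun f => (f.2.totalDeriv hΩ).toAlgebra
      map_zero' := Subtype.ext <| funext fun x =>
        (totalDeriv_congr hΩ (isDifferentialFunction_const 0)
          (fun y hy => jetExtend_apply _ hy) x.2).trans (congrFun (totalDeriv_const 0) _)
      map_add' := fun f g => Subtype.ext <| funext fun x =>
        (totalDeriv_congr hΩ (f.2.add g.2)
          (fun y hy => by simp [jetExtend_apply, hy]) x.2).trans (totalDeriv_add hΩ f.2 g.2 x.2) })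
    fun f g => Subtype.ext <| funext fun x => by
      refine ((totalDeriv_congr hΩ (f.2.mul g.2)
        (fun y hy => by simp [jetExtend_apply, hy]) x.2).trans
          (totalDeriv_mul hΩ f.2 g.2 x.2)).trans ?_
      rw [jetExtend_apply _ x.2, jetExtend_apply _ x.2]
      rfl

theorem totalDerivation_toAlgebra (hΩ : IsOpen Ω) (hf : IsDifferentialFunction Ω f) :
    totalDerivation hΩ hf.toAlgebra = (hf.totalDeriv hΩ).toAlgebra :=
  Subtype.ext <| funext fun x =>
    totalDeriv_congr hΩ hf (fun _ hy => jetExtend_apply _ hy) x.2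

theorem iterate_totalDerivation_toAlgebra (hΩ : IsOpen Ω) (hf : IsDifferentialFunction Ω f)
    (k : ℕ) :
    (totalDerivation hΩ)^[k] hf.toAlgebra = (hf.iterate_totalDeriv hΩ k).toAlgebra := by
  induction k with
  | zero => rfl
  | succ k ih =>
    rw [Function.iterate_succ_apply', ih, totalDerivation_toAlgebra]
    simp only [Function.iterate_succ_apply']

theorem IsDifferentialFunction.isUnit_toAlgebra (hf : IsDifferentialFunction Ω f)
    (h0 : ∀ x ∈ Ω, f x ≠ 0) : IsUnit hf.toAlgebra :=
  IsUnit.of_mul_eq_one (hf.inv h0).toAlgebra <| Subtype.ext <| funext fun x =>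
    mul_inv_cancel₀ (h0 x x.2)

/-- Evaluation of differential functions at a point. -/
def evalAlgebra (x : Ω) : differentialFunctions Ω →+* 𝕜 :=
  (Pi.evalRingHom (fun _ : Ω => 𝕜) x).comp (differentialFunctions Ω).val.toRingHom

/-! ### Darboux operators and part (1) -/

theorem isDifferentialFunction_det {p : ℕ} {F : Fin p → Fin p → JetSpace 𝕜 → 𝕜}
    (hF : ∀ i j, IsDifferentialFunction Ω (F i j)) :
    IsDifferentialFunction Ω fun x => (Matrix.of fun i j => F i j x).det := by
  refine (Matrix.of fun i j => (hF i j).toAlgebra).det.2.congr fun x hx => ?_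
  rw [jetExtend_apply _ hx]
  change _ = evalAlgebra ⟨x, hx⟩ (Matrix.det _)
  rw [RingHom.map_det]
  rfl

theorem isDifferentialFunction_totalWronskian (hΩ : IsOpen Ω) {p : ℕ}
    {lam : Fin p → JetSpace 𝕜 → 𝕜} (hlam : ∀ s, IsDifferentialFunction Ω (lam s)) :
    IsDifferentialFunction Ω (totalWronskian lam) :=
  isDifferentialFunction_det fun s l => (hlam s).iterate_totalDeriv hΩ l

theorem isOpen_darbouxDomain (hΩ : IsOpen Ω) {p : ℕ}
    {lam : Fin p → JetSpace 𝕜 → 𝕜} (hlam : ∀ s, IsDifferentialFunction Ω (lam s)) :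
    IsOpen (darbouxDomain Ω lam) :=
  (isDifferentialFunction_totalWronskian hΩ hlam).continuousOn.isOpen_inter_preimage hΩ
    isOpen_compl_singleton

theorem isDifferentialFunction_darbouxCoeff (hΩ : IsOpen Ω) {p : ℕ}
    {lam : Fin p → JetSpace 𝕜 → 𝕜} (hlam : ∀ s, IsDifferentialFunction Ω (lam s))
    (hW : ∀ x ∈ Ω, totalWronskian lam x ≠ 0) (k : Fin (p + 1)) :
    IsDifferentialFunction Ω (darbouxCoeff lam k) :=
  (((isDifferentialFunction_const ((-1) ^ (p + (k : ℕ)))).mul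
    (isDifferentialFunction_det fun s l =>
      (hlam s).iterate_totalDeriv hΩ (k.succAbove l : ℕ))).mul
        ((isDifferentialFunction_totalWronskian hΩ hlam).inv hW)).congr
          fun _ _ => div_eq_mul_inv _ _

theorem darbouxCoeff_last {p : ℕ} {lam : Fin p → JetSpace 𝕜 → 𝕜} {x : JetSpace 𝕜}
    (hW : totalWronskian lam x ≠ 0) : darbouxCoeff lam (Fin.last p) x = 1 := by
  have hsign : (-1 : 𝕜) ^ (p + p) = 1 := Even.neg_one_pow ⟨p, rfl⟩
  simp only [darbouxCoeff, Fin.val_last, hsign, one_mul, Fin.succAbove_last, Fin.val_castSucc]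
  exact div_self hW

/-- The Wronskian in the numerator has two equal rows. -/
theorem darbouxTransformation_self {p : ℕ} (lam : Fin p → JetSpace 𝕜 → 𝕜) (s : Fin p) :
    darbouxTransformation lam (lam s) = 0 := by
  funext x
  have : totalWronskian (Fin.snoc lam (lam s) : Fin (p + 1) → JetSpace 𝕜 → 𝕜) x = 0 :=
    Matrix.det_zero_of_row_eq (Fin.castSucc_lt_last s).ne (by ext l; simp)
  simp [darbouxTransformation, this]

theorem exists_firstIntegral_iff_exists_darbouxAdjoint (hΩ : IsOpen Ω) {p : ℕ}
    {L : JetSpace 𝕜 → 𝕜} (hL : IsDifferentialFunction Ω L)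
    {lam : Fin p → JetSpace 𝕜 → 𝕜} (hlam : ∀ s, IsDifferentialFunction Ω (lam s))
    (hW : ∀ x ∈ Ω, totalWronskian lam x ≠ 0) :
    (∃ I : Fin p → JetSpace 𝕜 → 𝕜, ∀ s, IsFirstIntegralWith Ω L (lam s) (I s)) ↔
      ∃ H : JetSpace 𝕜 → 𝕜, IsDifferentialFunction Ω H ∧ ∀ x ∈ Ω, L x = darbouxAdjoint lam H x := by
  set D := totalDerivation hΩ with hD
  have hψ := isDifferentialFunction_darbouxCoeff hΩ hlam hW
  let ψ : ℕ → differentialFunctions Ω := fun k => if h : k < p + 1 then (hψ ⟨k, h⟩).toAlgebra else 0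
  have hψk : ∀ k : Fin (p + 1), ψ k = (hψ k).toAlgebra := fun k => dif_pos k.2
  have hψp : ψ p = 1 := (hψk (Fin.last p)).trans <|
    Subtype.ext <| funext fun x => darbouxCoeff_last (hW x x.2)
  have hann : ∀ s, ∑ k ∈ Finset.range (p + 1), ψ k * D^[k] (hlam s).toAlgebra = 0 := by
    intro s
    rw [← Fin.sum_univ_eq_sum_range (fun k => ψ k * D^[k] (hlam s).toAlgebra)]
    refine Subtype.ext <| funext fun x => ?_
    change evalAlgebra x _ = 0
    rw [map_sum]
    have := congrFun ((totalOpApply_darbouxCoeff lam (lam s)).trans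
      (darbouxTransformation_self lam s)) x
    rw [← Pi.zero_apply (M := fun _ => 𝕜) (x : JetSpace 𝕜), ← this]
    refine Finset.sum_congr rfl fun k _ => ?_
    rw [map_mul, hψk, hD, iterate_totalDerivation_toAlgebra]
    rfl
  -- A nowhere vanishing Wronskian is invertible because its reciprocal is again a differential
  -- function.
  have hM : IsUnit (Matrix.of fun s l : Fin p => D^[(l : ℕ)] (hlam s).toAlgebra).det := by
    convert (isDifferentialFunction_totalWronskian hΩ hlam).isUnit_toAlgebra hW using 1
    refine Subtype.ext <| funext fun x => ?_
    change evalAlgebra x (Matrix.det _) = _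
    rw [RingHom.map_det]
    simp only [hD, iterate_totalDerivation_toAlgebra]
    rfl
  have key := D.exists_integral_iff_exists_adjoint hψp hann hM hL.toAlgebra
  have hadj : ∀ {H : JetSpace 𝕜 → 𝕜} (hH : IsDifferentialFunction Ω H),
      hL.toAlgebra = ∑ k ∈ Finset.range (p + 1), (-1) ^ k * D^[k] (ψ k * hH.toAlgebra) ↔
        ∀ x ∈ Ω, L x = darbouxAdjoint lam H x := by
    intro H hH
    have heval : ∀ x : Ω, evalAlgebra x
        (∑ k ∈ Finset.range (p + 1), (-1) ^ k * D^[k] (ψ k * hH.toAlgebra)) =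
          darbouxAdjoint lam H x := by
      intro x
      rw [← Fin.sum_univ_eq_sum_range (fun k => (-1) ^ k * D^[k] (ψ k * hH.toAlgebra)), map_sum]
      refine Finset.sum_congr rfl fun k _ => ?_
      have : ψ k * hH.toAlgebra = ((hψ k).mul hH).toAlgebra := by rw [hψk]; rfl
      rw [this, hD, iterate_totalDerivation_toAlgebra, map_mul, map_pow, map_neg, map_one]
      rfl
    constructor
    · intro h x hx
      rw [← heval ⟨x, hx⟩, ← h]
      rfl
    · intro h
      exact Subtype.ext <| funext fun x => (h x x.2).trans (heval x).symm
  constructor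
  · rintro ⟨I, hI⟩
    obtain ⟨H, hH⟩ := key.1 ⟨fun s => (hI s).1.toAlgebra, fun s =>
      (totalDerivation_toAlgebra hΩ (hI s).1).trans <|
        Subtype.ext <| funext fun x => (hI s).2 x x.2⟩
    refine ⟨jetExtend H.1, H.2, (hadj H.2).1 ?_⟩
    have : IsDifferentialFunction.toAlgebra H.2 = H :=
      Subtype.ext <| funext fun x => jetExtend_apply _ x.2
    rw [this]
    exact hH
  · rintro ⟨H, hH, h⟩
    obtain ⟨I, hI⟩ := key.2 ⟨hH.toAlgebra, (hadj hH).2 h⟩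
    exact ⟨fun s => jetExtend (I s).1, fun s => ⟨(I s).2, fun x hx =>
      congrFun (congrArg Subtype.val (hI s)) ⟨x, hx⟩⟩⟩

/-! ### Independence of the first integrals and part (2) -/

theorem totalDeriv_const_mul (hΩ : IsOpen Ω) (hf : IsDifferentialFunction Ω f) (c : 𝕜)
    {x : JetSpace 𝕜} (hx : x ∈ Ω) : totalDeriv (fun y => c * f y) x = c * totalDeriv f x := by
  rw [totalDeriv_mul hΩ (isDifferentialFunction_const c) hf hx, totalDeriv_const]
  simp

theorem totalDeriv_sum_const_mul (hΩ : IsOpen Ω) {ι : Type*} (s : Finset ι) (c : ι → 𝕜)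
    {F : ι → JetSpace 𝕜 → 𝕜} (hF : ∀ i, IsDifferentialFunction Ω (F i)) :
    IsDifferentialFunction Ω (fun y => ∑ i ∈ s, c i * F i y) ∧ ∀ x ∈ Ω,
      totalDeriv (fun y => ∑ i ∈ s, c i * F i y) x = ∑ i ∈ s, c i * totalDeriv (F i) x := by
  classical
  induction s using Finset.induction_on with
  | empty =>
    simp only [Finset.sum_empty]
    exact ⟨isDifferentialFunction_const 0, fun x _ => congrFun (totalDeriv_const 0) x⟩
  | insert i s hi ih =>
    have hci := (isDifferentialFunction_const (Ω := Ω) (c i)).mul (hF i)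
    simp only [Finset.sum_insert hi]
    refine ⟨hci.add ih.1, fun x hx => ?_⟩
    rw [totalDeriv_add hΩ hci ih.1 hx, ih.2 x hx, totalDeriv_const_mul hΩ (hF i) _ hx]

theorem totallyLinearlyIndependent_cons_one_of_isFirstIntegralWith {U : Set (JetSpace 𝕜)}
    {p : ℕ} {L : JetSpace 𝕜 → 𝕜} (hL : IsDifferentialFunction U L)
    (hgen : IsGenuineEquation U L) {lam I : Fin p → JetSpace 𝕜 → 𝕜}
    (hind : TotallyLinearlyIndependent U lam)
    (hI : ∀ s, IsFirstIntegralWith U L (lam s) (I s)) :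
    TotallyLinearlyIndependent U (Fin.cons (fun _ => 1) I : Fin (p + 1) → JetSpace 𝕜 → 𝕜) := by
  intro V hV hVne hVU
  rw [Fintype.linearIndependent_iff]
  intro c hc
  have hc' : ∀ x ∈ V, c 0 + ∑ s, c (Fin.succ s) * I s x = 0 := by
    intro x hx
    have := congrFun hc ⟨x, hx⟩
    simpa [Fin.sum_univ_succ, Finset.sum_apply] using this
  have hIV : ∀ s, IsDifferentialFunction V (I s) := fun s => (hI s).1.mono hVU
  have hsum := totalDeriv_sum_const_mul hV Finset.univ (fun s => c (Fin.succ s)) hIV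
  have hlin : ∀ x ∈ V, (∑ s, c (Fin.succ s) * lam s x) * L x = 0 := by
    intro x hx
    have h₀ : totalDeriv (fun y => c 0 + ∑ s, c (Fin.succ s) * I s y) x = 0 :=
      (totalDeriv_congr hV (isDifferentialFunction_const 0) hc' hx).trans
        (congrFun (totalDeriv_const 0) x)
    rw [totalDeriv_add hV (isDifferentialFunction_const _) hsum.1 hx, totalDeriv_const,
      hsum.2 x hx, Pi.zero_apply, zero_add] at h₀
    rw [← h₀, Finset.sum_mul]
    exact Finset.sum_congr rfl fun s _ => by rw [(hI s).2 x (hVU hx), mul_assoc]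
  obtain ⟨x₀, hx₀, hLx₀⟩ := hgen V hV hVne hVU
  -- On this nonempty open subset `L` can be cancelled from `hlin`; independence of `lam` on all
  -- open subsets is what makes it applicable here.
  have hli := hind (V ∩ L ⁻¹' {0}ᶜ)
    ((hL.mono hVU).continuousOn.isOpen_inter_preimage hV isOpen_compl_singleton)
    ⟨x₀, hx₀, hLx₀⟩ (Set.inter_subset_left.trans hVU)
  have hcs : ∀ s, c (Fin.succ s) = 0 := by
    refine Fintype.linearIndependent_iff.1 hli _ (funext fun x => ?_)
    have := (mul_eq_zero.1 (hlin x x.2.1)).resolve_right x.2.2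
    simpa [Finset.sum_apply] using this
  refine Fin.cases ?_ hcs
  simpa [hcs] using hc' x₀ hx₀

end

theorem mainTheorem1 {𝕜 : Type*} [RCLike 𝕜] {p : ℕ} (Ω : Set (JetSpace 𝕜)) (hΩ : IsOpen Ω)
    (L : JetSpace 𝕜 → 𝕜) (hL : IsDifferentialFunction Ω L)
    (lam : Fin p → JetSpace 𝕜 → 𝕜) (hlam : ∀ s, IsDifferentialFunction Ω (lam s))
    (hind : TotallyLinearlyIndependent Ω lam) :
    ((∃ I : Fin p → JetSpace 𝕜 → 𝕜,
        ∀ s, IsFirstIntegralWith (darbouxDomain Ω lam) L (lam s) (I s)) ↔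
      ∃ H : JetSpace 𝕜 → 𝕜, IsDifferentialFunction (darbouxDomain Ω lam) H ∧
        ∀ x ∈ darbouxDomain Ω lam, L x = darbouxAdjoint lam H x) ∧
    (IsGenuineEquation Ω L →
      ((∃ I : Fin p → JetSpace 𝕜 → 𝕜,
          TotallyLinearlyIndependent (darbouxDomain Ω lam)
            (Fin.cons (fun _ => 1) I : Fin (p + 1) → JetSpace 𝕜 → 𝕜) ∧
          ∀ s, IsFirstIntegralWith (darbouxDomain Ω lam) L (lam s) (I s)) ↔
        ∃ H : JetSpace 𝕜 → 𝕜, IsDifferentialFunction (darbouxDomain Ω lam) H ∧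
          ∀ x ∈ darbouxDomain Ω lam, L x = darbouxAdjoint lam H x)) := by
  have hU := isOpen_darbouxDomain hΩ hlam
  have hUΩ : darbouxDomain Ω lam ⊆ Ω := fun x hx => hx.1
  have hLU := hL.mono hUΩ
  have key := exists_firstIntegral_iff_exists_darbouxAdjoint hU hLU
    (fun s => (hlam s).mono hUΩ) fun x hx => hx.2
  -- One direction forgets independence; in the other, independence is automatic for any integrals
  -- supplied by part (1).
  refine ⟨key, fun hgen => ⟨fun ⟨I, _, hI⟩ => key.1 ⟨I, hI⟩, fun h => ?_⟩⟩
  obtain ⟨I, hI⟩ := key.2 h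
  exact ⟨I, totallyLinearlyIndependent_cons_one_of_isFirstIntegralWith hLU
    (fun V hV hne hVU => hgen V hV hne (hVU.trans hUΩ))
    (fun V hV hne hVU => hind V hV hne (hVU.trans hUΩ)) hI, hI⟩
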